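/- For finite multisets of complex parameters let $${}_pF_q(a_1,\dots,a_p;b_1,\dots,b_q;z)=\sum_{n\ge 0}\frac{(a_1)_n\cdots(a_p)_n}{(b_1)_n\cdots(b_q)_n}\frac{z^n}{n!},\qquad {}_p\tilde F_q(a_1,\dots,a_p;b_1,\dots,b_q;z)=\sum_{n\ge 0}\frac{(a_1)_n\cdots(a_p)_n}{\Gamma(b_1+n)\cdots\Gamma(b_q+n)}\frac{z^n}{n!}$$ denote the generalized hypergeometric function (defined when no $b_j$ is a non-positive integer) and its regularized version (where $1/\Gamma$ is read as $0$ at the poles of $\Gamma$). Let $\mu,\nu\ge 0$ be integers of the same parity and let $z\in\mathbb C$, with $z\ne 0$ unless $\mu=\nu\in\{0,1\}$. For $L\ge 0$ and $s\in\mathbb C$ put $$c_L=\frac{\pi^2(2L+1)\left((-1)^{L+\mu}+1\right)\left((-1)^{L+\nu}+1\right)\Gamma(2L+2)^2\, i^{4L-2\mu-2\nu}\,2^{-8L+\mu+\nu-6}}{\Gamma\left(\frac{2L+3}{2}\right)^2},$$ $$F_L(s)={}_2F_3\left(\tfrac L2+\tfrac12,\tfrac L2+1;\,L+\tfrac32,\tfrac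 L2-\tfrac s2+1,\tfrac L2+\tfrac s2+1;\,\tfrac z4\right),$$ and let $\tilde F_L(s)$ be the same expression with ${}_2\tilde F_3$ in place of ${}_2F_3$. Then $${}_3F_4\left(\tfrac{\mu+\nu+1}2,\tfrac{\mu+\nu+1}2,\tfrac{\mu+\nu}2+1;\,\mu+1,\tfrac{\mu+\nu+3}2,\nu+1,\mu+\nu+1;\,z\right)$$ $$=(\mu+\nu+1)\Gamma(\mu+1)\Gamma(\nu+1)\sum_{L=0}^\infty \frac{c_L\,z^{L-(\mu+\nu)/2}\,F_L(\mu)\,F_L(\nu)}{\Gamma\left(L+\frac32\right)^2\Gamma\left(\frac L2-\frac\mu2+1\right)\Gamma\left(\frac L2+\frac\mu2+1\right)\Gamma\left(\frac L2-\frac\nu2+1\right)\Gamma\left(\frac L2+\frac\nu2+1\right)}$$ $$=(\mu+\nu+1)\Gamma(\mu+1)\Gamma(\nu+1)\sum_{L=0}^\infty c_L\,z^{L-(\mu+\nu)/2}\,\tilde F_L(\mu)\,\tilde F_L(\nu),$$ and both series converge absolutely. In the first series, a summand with $L\equiv\mu\pmod 2$ and $L<\max(\mu,\nu)$ is an indeterminate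 form: a parameter $\frac L2-\frac\mu2+1$ or $\frac L2-\frac\nu2+1$ is then a non-positive integer. Such a summand is understood as its limit as $(s,t)\to(\mu,\nu)$ with $s\ne\mu$, $t\ne\nu$, where $s$ replaces $\mu$ and $t$ replaces $\nu$ in the four Gamma functions and in $F_L(\mu)F_L(\nu)$, while $c_L$ and the power of $z$ are kept fixed. These limits exist for every $L$. For all other $L$ the limit equals the summand as it is written. -/

import Mathlib

open Filter Topology

/-- The `n`-th coefficient `(a₁)ₙ ⋯ (aₚ)ₙ / (n! (b₁)ₙ ⋯ (b_q)ₙ)` of the generalized hypergeometric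
series, where `(x)ₙ = x (x + 1) ⋯ (x + n - 1)`. It is meaningful when no `bⱼ` is a non-positive
integer. -/
noncomputable def hgCoeff (a b : Multiset ℂ) (n : ℕ) : ℂ :=
  (a.map fun x => (ascPochhammer ℂ n).eval x).prod /
    ((n.factorial : ℂ) * (b.map fun x => (ascPochhammer ℂ n).eval x).prod)

/-- The (conventional) generalized hypergeometric function `pFq(a; b; z) = ∑ₙ hgCoeff a b n * zⁿ`.
Its regularized version is Mathlib's `Complex.regularizedHGFun`. -/
noncomputable def hgFun (a b : Multiset ℂ) (z : ℂ) : ℂ :=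
  (FormalMultilinearSeries.ofScalars ℂ (hgCoeff a b)).sum z

/-- The function `₃F₄((μ+ν+1)/2, (μ+ν+1)/2, (μ+ν)/2+1; μ+1, (μ+ν+3)/2, ν+1, μ+ν+1; z)`. -/
noncomputable def threeFfour (μ ν : ℕ) (z : ℂ) : ℂ :=
  hgFun
    {(μ : ℂ) / 2 + (ν : ℂ) / 2 + 1 / 2, (μ : ℂ) / 2 + (ν : ℂ) / 2 + 1 / 2,
      (μ : ℂ) / 2 + (ν : ℂ) / 2 + 1}
    {(μ : ℂ) + 1, (μ : ℂ) / 2 + (ν : ℂ) / 2 + 3 / 2, (ν : ℂ) + 1, (μ : ℂ) + (ν : ℂ) + 1} z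

/-- The upper parameters `L/2 + 1/2, L/2 + 1`. -/
noncomputable def upperParams (L : ℕ) : Multiset ℂ :=
  {(L : ℂ) / 2 + 1 / 2, (L : ℂ) / 2 + 1}

/-- The lower parameters `L + 3/2, L/2 - s/2 + 1, L/2 + s/2 + 1`, for a complex order `s`. -/
noncomputable def lowerParams (L : ℕ) (s : ℂ) : Multiset ℂ :=
  {(L : ℂ) + 3 / 2, (L : ℂ) / 2 - s / 2 + 1, (L : ℂ) / 2 + s / 2 + 1}

/-- The common part
`π² (2L+1) ((-1)^(L+μ)+1) ((-1)^(L+ν)+1) Γ(2L+2)² i^(4L-2μ-2ν) 2^(-8L+μ+ν-6) / Γ((2L+3)/2)²`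
of the prefactors of the `L`-th summands. -/
noncomputable def commonFactor (μ ν L : ℕ) : ℂ :=
  (Real.pi : ℂ) ^ 2 * (2 * (L : ℂ) + 1) * ((-1 : ℂ) ^ (L + μ) + 1) * ((-1 : ℂ) ^ (L + ν) + 1) *
      Complex.Gamma (2 * (L : ℂ) + 2) ^ 2 *
      Complex.I ^ (4 * (L : ℤ) - 2 * (μ : ℤ) - 2 * (ν : ℤ)) *
      (2 : ℂ) ^ (-8 * (L : ℤ) + (μ : ℤ) + (ν : ℤ) - 6) /
    Complex.Gamma ((2 * (L : ℂ) + 3) / 2) ^ 2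

/-- The power `z ^ (L - (μ+ν)/2)`. It is used only when `μ + ν` is even, so that the integer
division is exact. -/
noncomputable def powerFactor (μ ν L : ℕ) (z : ℂ) : ℂ :=
  z ^ ((L : ℤ) - ((μ : ℤ) + (ν : ℤ)) / 2)

/-- The `L`-th summand in the version with conventional `₂F₃` functions. In its Gamma functions and
its `₂F₃` functions the orders `μ, ν` are replaced by complex variables `s, t`, because at
`(s, t) = (μ, ν)` the quotients `₂F₃ / Γ` can be of the indeterminate form `∞ / ∞`. -/
noncomputable def conventionalSummand (μ ν L : ℕ) (z s t : ℂ) : ℂ :=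
  commonFactor μ ν L /
      (Complex.Gamma ((L : ℂ) + 3 / 2) ^ 2 *
        Complex.Gamma ((L : ℂ) / 2 - s / 2 + 1) * Complex.Gamma ((L : ℂ) / 2 + s / 2 + 1) *
        Complex.Gamma ((L : ℂ) / 2 - t / 2 + 1) * Complex.Gamma ((L : ℂ) / 2 + t / 2 + 1)) *
    powerFactor μ ν L z *
    hgFun (upperParams L) (lowerParams L s) (z / 4) *
    hgFun (upperParams L) (lowerParams L t) (z / 4)

/-- The `L`-th summand in the version with regularized `₂F̃₃` functions. -/
noncomputable def regularizedSummand (μ ν L : ℕ) (z : ℂ) : ℂ :=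
  commonFactor μ ν L * powerFactor μ ν L z *
    Complex.regularizedHGFun (upperParams L) (lowerParams L (μ : ℂ)) (z / 4) *
    Complex.regularizedHGFun (upperParams L) (lowerParams L (ν : ℂ)) (z / 4)

/-!
With `z = -k ^ 2`, the functions `₂F₃` are, up to elementary factors, the coefficients of the Legendre
expansion on `[-1, 1]` of the Bessel functions `x ↦ J_μ(k x)` and `x ↦ J_ν(k x)`, and the `₃F₄` is the
integral of their product: the theorem is Parseval's identity.

The proof needs neither Legendre polynomials nor integrals, only the moments
`M j L = ∫ x ^ j P_L(x) dx`, taken in closed form (`legendreMoment`). Parseval's identity for two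
monomials, `∑_L (2 L + 1) / 2 * M j L * M j' L = 2 / (j + j' + 1)`, is a finite sum that telescopes
(`sum_range_legendreMoment`, `hasSum_legendreMoment_mul`). Inserting the Bessel power series gives a
triple series, over two exponents and the degree `L`. As the moments are nonnegative, summing over `L`
first shows that it converges absolutely (`summable_besselTriple`). Summed over the exponents first, it
is the series of regularized summands (`hasSum_legendreMoment_mul_besselCoeff`,
`regularizedSummand_eq`); summed over `L` first and then along antidiagonals, it is the `₃F₄`, by
Vandermonde's identity (`sum_antidiagonal_besselCoeff_mul`, `threeFfour_eq_tsum`).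

The limits of the conventional summands are the regularized summands: near, but not at, integral orders
the two expressions agree (`conventionalSummand_eq`), and the regularized function is continuous in
the order (`continuous_regularizedHGFun_order`), because `1 / Γ(w + n)` decays factorially in `n`,
uniformly for bounded `w` (`exists_norm_inv_Gamma_add_le`).
-/

open scoped Nat

/-! ### Moments of Legendre polynomials -/

/-- The moment `∫ x ^ j P_L(x) dx` over `[-1, 1]` of the Legendre polynomial `P_L`, in closed form.
It vanishes unless `L ≤ j` and `L`, `j` have the same parity. -/
noncomputable def legendreMoment (j L : ℕ) : ℝ :=
  if L ≤ j ∧ Even (j + L) then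
    2 ^ (L + 1) * j ! * ((j + L) / 2)! / (((j - L) / 2)! * (j + L + 1)!)
  else 0

theorem legendreMoment_nonneg (j L : ℕ) : 0 ≤ legendreMoment j L := by
  unfold legendreMoment
  split_ifs <;> positivity

theorem legendreMoment_of_lt {j L : ℕ} (h : j < L) : legendreMoment j L = 0 :=
  if_neg fun h' => by omega

theorem legendreMoment_of_odd {j L : ℕ} (h : ¬ Even (j + L)) : legendreMoment j L = 0 :=
  if_neg fun h' => h h'.2

theorem legendreMoment_add_two_mul (L n : ℕ) :
    legendreMoment (L + 2 * n) L =
      2 ^ (L + 1) * (L + 2 * n)! * (L + n)! / (n ! * (2 * (L + n) + 1)!) := by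
  have h1 : L ≤ L + 2 * n ∧ Even (L + 2 * n + L) := ⟨by omega, L + n, by ring⟩
  rw [legendreMoment, if_pos h1]
  congr 4 <;> omega

/-- The first-order recurrence of the moments in the degree; it also covers the vanishing cases. -/
theorem legendreMoment_succ_succ (j L : ℕ) :
    (j + L + 3 : ℝ) * legendreMoment j (L + 2) = (j - L : ℝ) * legendreMoment j L := by
  by_cases hpar : Even (j + L)
  · rcases lt_or_ge j L with h | h
    · rw [legendreMoment_of_lt h, legendreMoment_of_lt (by omega), mul_zero, mul_zero]
    · obtain ⟨n, rfl⟩ : ∃ n, j = L + 2 * n := by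
        obtain ⟨k, hk⟩ := hpar
        exact ⟨k - L, by omega⟩
      rcases n with _ | n
      · rw [legendreMoment_of_lt (by omega)]
        simp
      · have e : L + 2 * (n + 1) = (L + 2) + 2 * n := by ring
        rw [legendreMoment_add_two_mul]
        rw [e, legendreMoment_add_two_mul]
        have e1 : 2 * (L + 2 + n) + 1 = 2 * (L + n + 1) + 1 + 1 + 1 := by ring
        have e2 : L + 2 + n = L + (n + 1) + 1 := by ring
        have e3 : 2 * (L + (n + 1)) + 1 = 2 * (L + n + 1) + 1 := by ring
        rw [e1, e2, e3, Nat.factorial_succ (L + (n + 1)), Nat.factorial_succ n,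
          Nat.factorial_succ (2 * (L + n + 1) + 1 + 1), Nat.factorial_succ (2 * (L + n + 1) + 1)]
        push_cast
        field_simp
        ring
  · rw [legendreMoment_of_odd hpar, legendreMoment_of_odd (by grind), mul_zero, mul_zero]

theorem legendreMoment_zero {j : ℕ} (h : Even j) : legendreMoment j 0 = 2 / (j + 1) := by
  obtain ⟨n, rfl⟩ := h
  have := legendreMoment_add_two_mul 0 n
  rw [show 0 + 2 * n = n + n by ring] at this
  rw [this, show 2 * (0 + n) + 1 = n + n + 1 by ring, Nat.factorial_succ, zero_add n]
  push_cast
  field_simp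

theorem legendreMoment_one {j : ℕ} (h : Odd j) : legendreMoment j 1 = 2 / (j + 2) := by
  obtain ⟨n, rfl⟩ := h
  have := legendreMoment_add_two_mul 1 n
  rw [show 1 + 2 * n = 2 * n + 1 by ring] at this
  rw [this, show 2 * (1 + n) + 1 = 2 * n + 1 + 1 + 1 by ring, Nat.factorial_succ (2 * n + 1 + 1),
    Nat.factorial_succ (2 * n + 1), show 1 + n = n + 1 by ring, Nat.factorial_succ n]
  push_cast
  field_simp
  ring

/-- The sum of `(2 L + 1) M_L M'_L` telescopes: each summand is proportional to `U L - U (L + 2)`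
where `U L = (j + L + 1) (j' + L + 1) M_L M'_L`. -/
theorem sum_range_legendreMoment (j j' N : ℕ) :
    (j + j' + 1 : ℝ) *
        ∑ L ∈ Finset.range N, (2 * L + 1 : ℝ) * (legendreMoment j L * legendreMoment j' L) =
      (j + 1 : ℝ) * (j' + 1) * (legendreMoment j 0 * legendreMoment j' 0) +
        (j + 2 : ℝ) * (j' + 2) * (legendreMoment j 1 * legendreMoment j' 1) -
        (j + N + 1 : ℝ) * (j' + N + 1) * (legendreMoment j N * legendreMoment j' N) -
        (j + N + 2 : ℝ) * (j' + N + 2) *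
          (legendreMoment j (N + 1) * legendreMoment j' (N + 1)) := by
  induction N with
  | zero => simp
  | succ N ih =>
    rw [Finset.sum_range_succ, mul_add, ih]
    have h1 := legendreMoment_succ_succ j N
    have h2 := legendreMoment_succ_succ j' N
    have h3 : (j + N + 3 : ℝ) * (j' + N + 3) *
        (legendreMoment j (N + 2) * legendreMoment j' (N + 2)) =
        (j - N : ℝ) * (j' - N) * (legendreMoment j N * legendreMoment j' N) := by
      linear_combination (j' + N + 3 : ℝ) * legendreMoment j' (N + 2) * h1 +
        (j - N : ℝ) * legendreMoment j N * h2
    push_cast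
    linear_combination h3

/-- Parseval's identity for the monomials `x ^ j` and `x ^ j'`, whose inner product on `[-1, 1]`
is `2 / (j + j' + 1)`. -/
theorem hasSum_legendreMoment_mul {j j' : ℕ} (h : Even (j + j')) :
    HasSum (fun L : ℕ => (2 * L + 1 : ℝ) / 4 * (legendreMoment j L * legendreMoment j' L))
      (1 / (j + j' + 1)) := by
  have hs : ∑ L ∈ Finset.range (j + 1),
      (2 * L + 1 : ℝ) / 4 * (legendreMoment j L * legendreMoment j' L) = 1 / (j + j' + 1) := by
    have key := sum_range_legendreMoment j j' (j + 1)
    rw [legendreMoment_of_lt (show j < j + 1 by omega),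
      legendreMoment_of_lt (show j < j + 1 + 1 by omega)] at key
    -- Of the two remaining boundary terms, of degrees `0` and `1`, one vanishes by parity.
    have h4 : (j + 1 : ℝ) * (j' + 1) * (legendreMoment j 0 * legendreMoment j' 0) +
        (j + 2 : ℝ) * (j' + 2) * (legendreMoment j 1 * legendreMoment j' 1) = 4 := by
      rcases Nat.even_or_odd j with hj | hj
      · have hj' : Even j' := by grind
        rw [legendreMoment_zero hj, legendreMoment_zero hj',
          legendreMoment_of_odd (show ¬ Even (j + 1) by grind)]
        field_simp
        norm_num
      · have hj' : Odd j' := by grind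
        rw [legendreMoment_one hj, legendreMoment_one hj',
          legendreMoment_of_odd (show ¬ Even (j + 0) by grind)]
        field_simp
        norm_num
    rw [h4] at key
    have h5 : ∑ L ∈ Finset.range (j + 1),
        (2 * L + 1 : ℝ) / 4 * (legendreMoment j L * legendreMoment j' L) =
        (∑ L ∈ Finset.range (j + 1),
          (2 * L + 1 : ℝ) * (legendreMoment j L * legendreMoment j' L)) / 4 := by
      rw [Finset.sum_div]
      exact Finset.sum_congr rfl fun _ _ => by ring
    rw [h5, eq_div_iff (by positivity)]
    linear_combination key / 4
  rw [← hs]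
  refine hasSum_sum_of_ne_finset_zero fun L hL => ?_
  rw [legendreMoment_of_lt (by simpa using hL), zero_mul, mul_zero]

/-! ### Gamma functions and rising factorials -/

theorem Gamma_natCast_add_three_halves (k : ℕ) :
    Complex.Gamma ((k : ℂ) + 3 / 2) =
      (2 * k + 1)! * (√Real.pi : ℝ) / (2 ^ (2 * k + 1) * k !) := by
  induction k with
  | zero =>
    have h := Complex.Gamma_add_one (1 / 2 : ℂ) (by norm_num)
    have h2 : Complex.Gamma (1 / 2) = (√Real.pi : ℝ) := by
      rw [← Real.Gamma_one_half_eq, ← Complex.Gamma_ofReal]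
      norm_num
    rw [h2] at h
    norm_num at h ⊢
    rw [h]
    ring
  | succ k ih =>
    have hne : (k : ℂ) + 3 / 2 ≠ 0 := by
      have : ((2 * k + 3 : ℕ) : ℂ) ≠ 0 := Nat.cast_ne_zero.mpr (by omega)
      intro h
      exact this (by push_cast; linear_combination 2 * h)
    have h := Complex.Gamma_add_one _ hne
    rw [show ((k + 1 : ℕ) : ℂ) + 3 / 2 = (k : ℂ) + 3 / 2 + 1 by push_cast; ring, h, ih,
      show 2 * (k + 1) + 1 = 2 * k + 1 + 1 + 1 by ring, Nat.factorial_succ (2 * k + 1 + 1),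
      Nat.factorial_succ (2 * k + 1), Nat.factorial_succ k]
    have : (k : ℂ) + 1 ≠ 0 := Nat.cast_add_one_ne_zero k
    push_cast
    field_simp
    ring

theorem ascPochhammer_eval_natCast_add_one (k n : ℕ) :
    (ascPochhammer ℂ n).eval ((k : ℂ) + 1) = (k + n)! / k ! := by
  induction n with
  | zero => simp [Nat.factorial_ne_zero]
  | succ n ih =>
    rw [ascPochhammer_succ_eval, ih, ← add_assoc, Nat.factorial_succ]
    push_cast
    ring

/-- The duplication formula for rising factorials with natural number data. -/
theorem ascPochhammer_eval_half_mul (k n : ℕ) :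
    (ascPochhammer ℂ n).eval ((k : ℂ) / 2 + 1 / 2) * (ascPochhammer ℂ n).eval ((k : ℂ) / 2 + 1) =
      (k + 2 * n)! / (k ! * 4 ^ n) := by
  induction n with
  | zero => simp [Nat.factorial_ne_zero]
  | succ n ih =>
    rw [ascPochhammer_succ_eval, ascPochhammer_succ_eval, mul_mul_mul_comm, ih,
      show k + 2 * (n + 1) = k + 2 * n + 1 + 1 by ring, Nat.factorial_succ, Nat.factorial_succ]
    push_cast
    field_simp
    ring

/-! ### Legendre coefficients of Bessel functions -/

theorem hasSum_regularizedHGFun {a b : Multiset ℂ} (h : a.card ≤ b.card) (z : ℂ) :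
    HasSum (fun n => Complex.regularizedHGFunCoeff a b n * z ^ n)
      (Complex.regularizedHGFun a b z) := by
  have hs := (Complex.regularizedHGFunSeries a b).hasSum (x := z) (by
    rw [Complex.radius_regularizedHGFunSeries_eq_top h]; simp)
  simpa [mul_comm, Complex.regularizedHGFunSeries, Complex.regularizedHGFun,
    FormalMultilinearSeries.ofScalars_apply_eq] using hs

theorem hgFun_eq_tsum (a b : Multiset ℂ) (z : ℂ) :
    hgFun a b z = ∑' n, hgCoeff a b n * z ^ n :=
  FormalMultilinearSeries.ofScalars_sum_eq (hgCoeff a b) z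

/-- The coefficient of `z ^ m` in the series of `(2 / √z) ^ μ I_μ(√z)`. -/
noncomputable def besselCoeff (μ m : ℕ) : ℝ := 1 / (4 ^ m * m ! * (m + μ)!)

theorem besselCoeff_nonneg (μ m : ℕ) : 0 ≤ besselCoeff μ m := by
  unfold besselCoeff; positivity

theorem summable_besselCoeff_mul_pow (μ : ℕ) (r : ℝ) (hr : 0 ≤ r) :
    Summable fun m => besselCoeff μ m * r ^ m := by
  refine Summable.of_nonneg_of_le (fun m => mul_nonneg (besselCoeff_nonneg μ m) (pow_nonneg hr m))
    (fun m => ?_) (Real.summable_pow_div_factorial r)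
  rw [besselCoeff, one_div_mul_eq_div]
  refine div_le_div_of_nonneg_left (pow_nonneg hr m) (by positivity) ?_
  have h1 : (1 : ℝ) ≤ 4 ^ m := one_le_pow₀ (by norm_num)
  have h2 : (1 : ℝ) ≤ (m + μ)! := by exact_mod_cast Nat.factorial_pos _
  have h3 : (0 : ℝ) ≤ m ! := by positivity
  nlinarith [mul_le_mul h1 h2 zero_le_one (by positivity), h3,
    mul_nonneg h3 (sub_nonneg.mpr (mul_le_mul h1 h2 zero_le_one (by positivity)))]

/-- Two series whose terms of indices `m` and `n` agree when `2 m + μ = L + 2 n`, and whose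
unmatched terms vanish, have the same sum. -/
theorem HasSum.of_two_mul_add_eq {f g : ℕ → ℂ} {S : ℂ} {μ L : ℕ} (hpar : Even (L + μ))
    (hfg : ∀ m n, 2 * m + μ = L + 2 * n → f m = g n) (hf : ∀ m, 2 * m + μ < L → f m = 0)
    (hg : ∀ n, L + 2 * n < μ → g n = 0) (h : HasSum g S) : HasSum f S := by
  rcases le_total L μ with hle | hle
  · obtain ⟨d, rfl⟩ : ∃ d, μ = L + 2 * d := by
      obtain ⟨k, hk⟩ := hpar
      exact ⟨k - L, by omega⟩
    have e : f = g ∘ (· + d) := funext fun m => hfg m (m + d) (by ring)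
    rw [e]
    refine ((add_left_injective d).hasSum_iff fun n hn => hg n ?_).mpr h
    by_contra hc
    exact hn ⟨n - d, Nat.sub_add_cancel (by omega)⟩
  · obtain ⟨d, rfl⟩ : ∃ d, L = μ + 2 * d := by
      obtain ⟨k, hk⟩ := hpar
      exact ⟨k - μ, by omega⟩
    have e : g = f ∘ (· + d) := funext fun n => (hfg (n + d) n (by ring)).symm
    rw [e] at h
    refine ((add_left_injective d).hasSum_iff fun m hm => hf m ?_).mp h
    by_contra hc
    exact hm ⟨m - d, Nat.sub_add_cancel (by omega)⟩

theorem regularizedHGFunCoeff_upper_lower (L n : ℕ) (s : ℂ) :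
    Complex.regularizedHGFunCoeff (upperParams L) (lowerParams L s) n =
      (L + 2 * n)! / (L ! * 4 ^ n) /
        (n ! * (Complex.Gamma ((L + n : ℕ) + 3 / 2) *
          (Complex.Gamma ((L : ℂ) / 2 - s / 2 + 1 + n) *
            Complex.Gamma ((L : ℂ) / 2 + s / 2 + 1 + n)))) := by
  rw [← ascPochhammer_eval_half_mul]
  simp only [Complex.regularizedHGFunCoeff, upperParams, lowerParams, Multiset.insert_eq_cons,
    Multiset.map_cons, Multiset.map_singleton, Multiset.prod_cons, Multiset.prod_singleton]
  push_cast
  congr 4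
  ring

/-- The Legendre coefficient of a Bessel function is, up to elementary factors, the regularized `₂F̃₃`
function. The exponent `n` of the latter corresponds to the exponent `m` of the Bessel series with
`2 m + μ = L + 2 n`. For `z = 0` the condition `μ ≤ L` excludes negative powers of `z`. -/
theorem hasSum_legendreMoment_mul_besselCoeff {μ L : ℕ} {z : ℂ} (hpar : Even (L + μ))
    (hz : z ≠ 0 ∨ μ ≤ L) :
    HasSum (fun m => (legendreMoment (2 * m + μ) L : ℂ) * (besselCoeff μ m * z ^ m))
      ((√Real.pi : ℝ) * L ! * (2 : ℂ) ^ ((μ : ℤ) - 2 * L) * z ^ (((L : ℤ) - μ) / 2) *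
        Complex.regularizedHGFun (upperParams L) (lowerParams L μ) (z / 4)) := by
  refine HasSum.of_two_mul_add_eq hpar ?_ (fun m hm => ?_) (fun n hn => ?_)
    ((hasSum_regularizedHGFun (by simp [upperParams, lowerParams]) (z / 4)).mul_left _)
  · intro m n hmn
    have hz' : z ^ m = z ^ (((L : ℤ) - μ) / 2) * z ^ n := by
      rcases hz with hz | hz
      · rw [← zpow_natCast z m, ← zpow_natCast z n, ← zpow_add₀ hz]
        congr 1
        omega
      · rw [show ((L : ℤ) - μ) / 2 = ((m - n : ℕ) : ℤ) by omega, zpow_natCast, ← pow_add]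
        congr 1
        omega
    rw [hmn, legendreMoment_add_two_mul, regularizedHGFunCoeff_upper_lower, hz', div_pow,
      Gamma_natCast_add_three_halves, besselCoeff]
    have e1 : (L : ℂ) / 2 - (μ : ℂ) / 2 + 1 + n = m + 1 := by
      have : (2 * m + μ : ℂ) = L + 2 * n := by exact_mod_cast hmn
      linear_combination this / -2
    have e2 : (L : ℂ) / 2 + (μ : ℂ) / 2 + 1 + n = (m + μ : ℕ) + 1 := by
      have : (2 * m + μ : ℂ) = L + 2 * n := by exact_mod_cast hmn
      push_cast
      linear_combination this / -2
    rw [e1, e2, Complex.Gamma_nat_eq_factorial, Complex.Gamma_nat_eq_factorial]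
    have e3 : (2 : ℂ) ^ ((μ : ℤ) - 2 * L) = 4 ^ n / (2 ^ L * 4 ^ m) := by
      rw [show (4 : ℂ) = 2 ^ 2 by norm_num, ← pow_mul, ← pow_mul, ← zpow_natCast, ← zpow_natCast,
        ← zpow_natCast, ← zpow_add₀ two_ne_zero, ← zpow_sub₀ two_ne_zero]
      congr 1
      push_cast
      omega
    have e4 : (2 : ℂ) ^ (2 * (L + n) + 1) = 2 * 2 ^ L * 2 ^ L * 4 ^ n := by
      rw [show (4 : ℂ) = 2 ^ 2 by norm_num, ← pow_mul]
      ring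
    have hpi : ((√Real.pi : ℝ) : ℂ) ≠ 0 := by
      exact_mod_cast (Real.sqrt_pos.mpr Real.pi_pos).ne'
    rw [e3, e4]
    have hL : (L ! : ℂ) ≠ 0 := Nat.cast_ne_zero.mpr (Nat.factorial_ne_zero L)
    push_cast
    field_simp
    ring
  · rw [legendreMoment_of_lt hm, Complex.ofReal_zero, zero_mul]
  -- For `L + 2 n < μ` the argument of `Γ(L/2 - μ/2 + 1 + n)` is a pole, whose reciprocal is `0`.
  · rw [Complex.regularizedHGFunCoeff_eq_zero_iff.mpr, zero_mul, mul_zero]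
    right
    obtain ⟨d, rfl⟩ : ∃ d, μ = L + 2 * n + 2 + 2 * d := by
      obtain ⟨k, hk⟩ := hpar
      exact ⟨k - L - n - 1, by omega⟩
    refine ⟨(L : ℂ) / 2 - (L + 2 * n + 2 + 2 * d : ℕ) / 2 + 1, by simp [lowerParams], d, ?_⟩
    push_cast
    ring

theorem commonFactor_of_odd {μ ν L : ℕ} (h : ¬ Even (L + μ)) : commonFactor μ ν L = 0 := by
  rw [commonFactor, (Nat.not_even_iff_odd.mp h).neg_one_pow]
  simp

theorem commonFactor_of_even {μ ν L : ℕ} (hμ : Even (L + μ)) (hν : Even (L + ν)) :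
    commonFactor μ ν L = (2 * L + 1) / 4 *
      (((√Real.pi : ℝ) * L ! * (2 : ℂ) ^ ((μ : ℤ) - 2 * L)) *
        ((√Real.pi : ℝ) * L ! * (2 : ℂ) ^ ((ν : ℤ) - 2 * L))) := by
  have hI : Complex.I ^ (4 * (L : ℤ) - 2 * (μ : ℤ) - 2 * (ν : ℤ)) = 1 := by
    obtain ⟨a, ha⟩ := hμ
    obtain ⟨b, hb⟩ := hν
    rw [show 4 * (L : ℤ) - 2 * (μ : ℤ) - 2 * (ν : ℤ) = ((4 : ℕ) : ℤ) * (2 * L - a - b) by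
      push_cast; omega, zpow_mul, zpow_natCast, Complex.I_pow_four, one_zpow]
  have hG : Complex.Gamma (2 * (L : ℂ) + 2) = (2 * L + 1)! := by
    rw [← Complex.Gamma_nat_eq_factorial]
    push_cast
    ring_nf
  have hpi : (Real.pi : ℂ) = (√Real.pi : ℝ) ^ 2 := by
    rw [← Complex.ofReal_pow, Real.sq_sqrt Real.pi_pos.le]
  have hpi0 : ((√Real.pi : ℝ) : ℂ) ≠ 0 := by
    exact_mod_cast (Real.sqrt_pos.mpr Real.pi_pos).ne'
  have h2 : (2 : ℂ) ^ (-8 * (L : ℤ) + (μ : ℤ) + (ν : ℤ) - 6) =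
      2 ^ ((μ : ℤ) - 2 * L) * 2 ^ ((ν : ℤ) - 2 * L) / (2 ^ (2 * L + 1)) ^ 2 / 16 := by
    rw [show (16 : ℂ) = 2 ^ 4 by norm_num, ← pow_mul, div_div, ← pow_add, ← zpow_natCast,
      ← zpow_add₀ two_ne_zero, ← zpow_sub₀ two_ne_zero]
    congr 1
    push_cast
    ring
  have hf : ((2 * L + 1)! : ℂ) ≠ 0 := Nat.cast_ne_zero.mpr (Nat.factorial_ne_zero _)
  have hL : (L ! : ℂ) ≠ 0 := Nat.cast_ne_zero.mpr (Nat.factorial_ne_zero _)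
  rw [commonFactor, hμ.neg_one_pow, hν.neg_one_pow, hI, hG, h2,
    show (2 * (L : ℂ) + 3) / 2 = L + 3 / 2 by ring, Gamma_natCast_add_three_halves, hpi]
  field_simp
  ring

/-- The integral over `[-1, 1]` of `x ↦ ∑ₘ besselCoeff μ m * z ^ m * x ^ (2 m + μ)` against the Legendre
polynomial `P_L`, expanded in powers of `z`. -/
noncomputable def besselMoment (μ L : ℕ) (z : ℂ) : ℂ :=
  ∑' m, (legendreMoment (2 * m + μ) L : ℂ) * (besselCoeff μ m * z ^ m)

theorem regularizedSummand_eq {μ ν : ℕ} (hparity : Even (μ + ν)) {z : ℂ}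
    (hz : z ≠ 0 ∨ (μ = ν ∧ μ ≤ 1)) (L : ℕ) :
    regularizedSummand μ ν L z =
      (2 * L + 1) / 4 * (besselMoment μ L z * besselMoment ν L z) := by
  by_cases hμ : Even (L + μ)
  · have hν : Even (L + ν) := by grind
    have hzμ : z ≠ 0 ∨ μ ≤ L := hz.imp_right fun h => by grind
    have hzν : z ≠ 0 ∨ ν ≤ L := hz.imp_right fun h => by grind
    have hpow : powerFactor μ ν L z = z ^ (((L : ℤ) - μ) / 2) * z ^ (((L : ℤ) - ν) / 2) := by
      rw [powerFactor, show (L : ℤ) - ((μ : ℤ) + ν) / 2 = ((L : ℤ) - μ) / 2 + ((L : ℤ) - ν) / 2 by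
        grind]
      -- At `z = 0` additivity of the exponents holds because both are then nonnegative.
      by_cases h0 : z = 0
      · obtain ⟨d, hd⟩ : ∃ d : ℕ, ((L : ℤ) - μ) / 2 = d :=
          ⟨(L - μ) / 2, by have := hzμ.resolve_left (not_not.mpr h0); omega⟩
        obtain ⟨e, he⟩ : ∃ e : ℕ, ((L : ℤ) - ν) / 2 = e :=
          ⟨(L - ν) / 2, by have := hzν.resolve_left (not_not.mpr h0); omega⟩
        rw [hd, he, ← Nat.cast_add, zpow_natCast, zpow_natCast, zpow_natCast, pow_add]
      · exact zpow_add₀ h0 _ _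
    rw [regularizedSummand, besselMoment, besselMoment,
      (hasSum_legendreMoment_mul_besselCoeff hμ hzμ).tsum_eq,
      (hasSum_legendreMoment_mul_besselCoeff hν hzν).tsum_eq, commonFactor_of_even hμ hν, hpow]
    ring
  · have h0 : besselMoment μ L z = 0 := by
      rw [besselMoment, tsum_congr fun m => ?_, tsum_zero]
      rw [legendreMoment_of_odd (by grind), Complex.ofReal_zero, zero_mul]
    rw [regularizedSummand, commonFactor_of_odd hμ, h0]
    simp

/-! ### The coefficients of the `₃F₄` -/

/-- Vandermonde's identity: the Cauchy product of two Bessel series has closed form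
coefficients. -/
theorem sum_antidiagonal_besselCoeff_mul (μ ν p : ℕ) :
    ∑ x ∈ Finset.HasAntidiagonal.antidiagonal p, besselCoeff μ x.1 * besselCoeff ν x.2 =
      (2 * p + μ + ν)! / (4 ^ p * p ! * (p + μ)! * (p + ν)! * (p + μ + ν)!) := by
  have h := Nat.add_choose_eq (p + ν) (p + μ) p
  have h1 : ∀ x ∈ Finset.HasAntidiagonal.antidiagonal p, besselCoeff μ x.1 * besselCoeff ν x.2 =
      ((p + ν).choose x.1 * (p + μ).choose x.2 : ℕ) / (4 ^ p * (p + μ)! * (p + ν)!) := by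
    rintro ⟨m, n⟩ hx
    obtain rfl : m + n = p := by simpa using hx
    rw [besselCoeff, besselCoeff, Nat.cast_mul, Nat.cast_choose ℝ (by omega : m ≤ m + n + ν),
      Nat.cast_choose ℝ (by omega : n ≤ m + n + μ), show m + n + ν - m = n + ν by omega,
      show m + n + μ - n = m + μ by omega, pow_add]
    field_simp
  rw [Finset.sum_congr rfl h1, ← Finset.sum_div, ← Nat.cast_sum, ← h,
    Nat.cast_choose ℝ (by omega), show p + ν + (p + μ) - p = p + μ + ν by omega,
    show p + ν + (p + μ) = 2 * p + μ + ν by ring]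
  field_simp

/-- In closed form, by the duplication formula for the parameters `(μ+ν+1)/2`, `(μ+ν)/2+1`, and since
the other `(μ+ν+1)/2` cancels against `(μ+ν+3)/2` up to a linear factor. -/
theorem hgCoeff_threeFfour (μ ν p : ℕ) :
    hgCoeff
      {(μ : ℂ) / 2 + (ν : ℂ) / 2 + 1 / 2, (μ : ℂ) / 2 + (ν : ℂ) / 2 + 1 / 2,
        (μ : ℂ) / 2 + (ν : ℂ) / 2 + 1}
      {(μ : ℂ) + 1, (μ : ℂ) / 2 + (ν : ℂ) / 2 + 3 / 2, (ν : ℂ) + 1, (μ : ℂ) + (ν : ℂ) + 1} p =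
      (μ + ν + 1) * μ ! * ν ! * (((2 * p + μ + ν)! /
        (4 ^ p * p ! * (p + μ)! * (p + ν)! * (p + μ + ν)!)) / (2 * p + μ + ν + 1)) := by
  have hne : ∀ k : ℕ, (μ : ℂ) + ν + 1 + 2 * k ≠ 0 := fun k => by
    exact_mod_cast (show μ + ν + 1 + 2 * k ≠ 0 by omega)
  have hshift : (ascPochhammer ℂ p).eval ((μ : ℂ) / 2 + (ν : ℂ) / 2 + 3 / 2) =
      (ascPochhammer ℂ p).eval ((μ : ℂ) / 2 + (ν : ℂ) / 2 + 1 / 2) *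
        ((μ + ν + 1 + 2 * p) / (μ + ν + 1)) := by
    have h0 := hne 0
    simp only [Nat.cast_zero, mul_zero, add_zero] at h0
    induction p with
    | zero => simp [h0]
    | succ p ih =>
      rw [ascPochhammer_succ_eval, ascPochhammer_succ_eval, ih]
      push_cast
      field_simp
      ring
  have hdup := ascPochhammer_eval_half_mul (μ + ν) p
  rw [show ((μ + ν : ℕ) : ℂ) / 2 = (μ : ℂ) / 2 + (ν : ℂ) / 2 by push_cast; ring] at hdup
  have hnz : (ascPochhammer ℂ p).eval ((μ : ℂ) / 2 + (ν : ℂ) / 2 + 1 / 2) ≠ 0 := by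
    intro h0
    rw [h0, zero_mul] at hdup
    have h1 : ((μ + ν + 2 * p)! : ℂ) ≠ 0 := Nat.cast_ne_zero.mpr (Nat.factorial_ne_zero _)
    have h2 : ((μ + ν)! : ℂ) ≠ 0 := Nat.cast_ne_zero.mpr (Nat.factorial_ne_zero _)
    exact div_ne_zero h1 (mul_ne_zero h2 (by norm_num)) hdup.symm
  have h3 := ascPochhammer_eval_natCast_add_one (μ + ν) p
  rw [Nat.cast_add] at h3
  simp only [hgCoeff, Multiset.insert_eq_cons, Multiset.map_cons, Multiset.map_singleton,
    Multiset.prod_cons, Multiset.prod_singleton]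
  rw [hdup, hshift, h3, ascPochhammer_eval_natCast_add_one, ascPochhammer_eval_natCast_add_one]
  have hf : ∀ k : ℕ, (k ! : ℂ) ≠ 0 := fun k => Nat.cast_ne_zero.mpr (Nat.factorial_ne_zero k)
  have h0 := hne 0
  simp only [Nat.cast_zero, mul_zero, add_zero] at h0
  have hp := hne p
  have hp' : 2 * (p : ℂ) + μ + ν + 1 ≠ 0 := by convert hp using 1; ring
  have := hf (μ + ν)
  have := hf μ
  have := hf ν
  have := hf p
  have := hf (p + μ)
  have := hf (p + ν)
  have := hf (p + μ + ν)
  rw [show μ + ν + 2 * p = 2 * p + μ + ν by ring, show μ + ν + p = p + μ + ν by ring,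
    add_comm μ p, add_comm ν p]
  generalize (ascPochhammer ℂ p).eval ((μ : ℂ) / 2 + (ν : ℂ) / 2 + 1 / 2) = P at hnz ⊢
  field_simp
  ring

/-! ### Parseval's identity for Bessel functions -/

/-- A crude bound, from the diagonal case of Parseval's identity. -/
theorem legendreMoment_le_two (j L : ℕ) : legendreMoment j L ≤ 2 := by
  have h := hasSum_legendreMoment_mul (j := j) (j' := j) ⟨j, rfl⟩
  have h1 := le_hasSum h L fun i _ => mul_nonneg (by positivity) (mul_self_nonneg _)
  have h2 : (1 : ℝ) / (j + j + 1) ≤ 1 := by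
    rw [div_le_one (by positivity)]
    linarith [(Nat.cast_nonneg j : (0 : ℝ) ≤ j)]
  have h3 : (0 : ℝ) ≤ L * (legendreMoment j L * legendreMoment j L) :=
    mul_nonneg (Nat.cast_nonneg L) (mul_self_nonneg _)
  nlinarith

theorem norm_besselCoeff_mul_pow (μ m : ℕ) (z : ℂ) :
    ‖(besselCoeff μ m : ℂ) * z ^ m‖ = besselCoeff μ m * ‖z‖ ^ m := by
  rw [norm_mul, norm_pow, Complex.norm_of_nonneg (besselCoeff_nonneg μ m)]

theorem summable_norm_besselCoeff_mul_pow (μ : ℕ) (z : ℂ) :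
    Summable fun m => ‖(besselCoeff μ m : ℂ) * z ^ m‖ := by
  simp only [norm_besselCoeff_mul_pow]
  exact summable_besselCoeff_mul_pow μ ‖z‖ (norm_nonneg z)

theorem summable_norm_legendreMoment_mul (μ L : ℕ) (z : ℂ) :
    Summable fun m =>
      ‖(legendreMoment (2 * m + μ) L : ℂ) * ((besselCoeff μ m : ℂ) * z ^ m)‖ := by
  refine Summable.of_nonneg_of_le (fun m => norm_nonneg _) (fun m => ?_)
    ((summable_norm_besselCoeff_mul_pow μ z).mul_left 2)
  rw [norm_mul, Complex.norm_of_nonneg (legendreMoment_nonneg _ _)]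
  exact mul_le_mul_of_nonneg_right (legendreMoment_le_two _ _) (norm_nonneg _)

/-- The term of the triple series obtained by inserting the power series of two Bessel functions
into Parseval's identity. The pair `x.1` indexes the powers, `x.2` is the Legendre degree. -/
noncomputable def besselTriple (μ ν : ℕ) (z : ℂ) (x : (ℕ × ℕ) × ℕ) : ℂ :=
  ((2 * x.2 + 1 : ℝ) / 4 *
      (legendreMoment (2 * x.1.1 + μ) x.2 * legendreMoment (2 * x.1.2 + ν) x.2) : ℝ) *
    ((besselCoeff μ x.1.1 * z ^ x.1.1) * (besselCoeff ν x.1.2 * z ^ x.1.2))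

/-- The weights of the Legendre expansion are nonnegative, so summing over the degree first, by
Parseval's identity, bounds the whole triple series. -/
theorem summable_besselTriple {μ ν : ℕ} (hparity : Even (μ + ν)) (z : ℂ) :
    Summable (besselTriple μ ν z) := by
  have hM : ∀ x : ℕ × ℕ, HasSum (fun L : ℕ => ‖besselTriple μ ν z (x, L)‖)
      (1 / ((2 * x.1 + μ : ℕ) + (2 * x.2 + ν : ℕ) + 1) *
        ‖(besselCoeff μ x.1 * z ^ x.1) * (besselCoeff ν x.2 * z ^ x.2)‖) := fun x => by
    have h := (hasSum_legendreMoment_mul (j := 2 * x.1 + μ) (j' := 2 * x.2 + ν)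
      (by grind)).mul_right ‖((besselCoeff μ x.1 : ℂ) * z ^ x.1) * (besselCoeff ν x.2 * z ^ x.2)‖
    refine h.congr_fun fun L => ?_
    rw [besselTriple, norm_mul, Complex.norm_of_nonneg]
    exact mul_nonneg (by positivity) (mul_nonneg (legendreMoment_nonneg _ _)
      (legendreMoment_nonneg _ _))
  refine Summable.of_norm
    ((summable_prod_of_nonneg fun x => norm_nonneg _).mpr ⟨fun x => (hM x).summable, ?_⟩)
  simp only [(hM _).tsum_eq]
  refine Summable.of_nonneg_of_le (fun x => by positivity) (fun x => ?_)
    (((summable_norm_besselCoeff_mul_pow μ z).mul_norm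
      (summable_norm_besselCoeff_mul_pow ν z)))
  refine mul_le_of_le_one_left (norm_nonneg _) ?_
  rw [div_le_one (by positivity)]
  have : (0 : ℝ) ≤ (2 * x.1 + μ : ℕ) + (2 * x.2 + ν : ℕ) := by positivity
  linarith

/-- Parseval's identity for a product of two Bessel functions. -/
theorem hasSum_besselMoment_mul {μ ν : ℕ} (hparity : Even (μ + ν)) (z : ℂ) :
    HasSum (fun L : ℕ => (2 * L + 1 : ℂ) / 4 * (besselMoment μ L z * besselMoment ν L z))
      (∑' x : ℕ × ℕ, 1 / ((2 * x.1 + μ : ℕ) + (2 * x.2 + ν : ℕ) + 1 : ℂ) *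
        ((besselCoeff μ x.1 * z ^ x.1) * (besselCoeff ν x.2 * z ^ x.2))) := by
  have hs := summable_besselTriple hparity z
  -- Summation over the degree is Parseval's identity for monomials.
  have hM : ∀ x : ℕ × ℕ, HasSum (fun L : ℕ => besselTriple μ ν z (x, L))
      (1 / ((2 * x.1 + μ : ℕ) + (2 * x.2 + ν : ℕ) + 1 : ℂ) *
        ((besselCoeff μ x.1 * z ^ x.1) * (besselCoeff ν x.2 * z ^ x.2))) := fun x => by
    have h := Complex.hasSum_ofReal.mpr
      (hasSum_legendreMoment_mul (j := 2 * x.1 + μ) (j' := 2 * x.2 + ν) (by grind))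
    rw [Complex.ofReal_div, Complex.ofReal_one, Complex.ofReal_add, Complex.ofReal_add,
      Complex.ofReal_one, Complex.ofReal_natCast, Complex.ofReal_natCast] at h
    exact (h.mul_right (((besselCoeff μ x.1 : ℂ) * z ^ x.1) *
      (besselCoeff ν x.2 * z ^ x.2))).congr_fun fun L => by rw [besselTriple]
  rw [(hs.hasSum.prod_fiberwise hM).tsum_eq]
  -- Summation over the two exponents gives the product of two Legendre coefficients.
  have h2 : HasSum (fun x : ℕ × (ℕ × ℕ) => besselTriple μ ν z (x.2, x.1))
      (∑' x, besselTriple μ ν z x) := (Equiv.prodComm ℕ (ℕ × ℕ)).hasSum_iff.mpr hs.hasSum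
  refine h2.prod_fiberwise fun L => ?_
  have h3 := summable_norm_legendreMoment_mul μ L z
  have h4 := summable_norm_legendreMoment_mul ν L z
  have h5 := (summable_mul_of_summable_norm h3 h4).hasSum
  rw [← tsum_mul_tsum_of_summable_norm h3 h4] at h5
  refine (h5.mul_left ((2 * L + 1 : ℂ) / 4)).congr_fun fun x => ?_
  rw [besselTriple]
  push_cast
  ring

theorem threeFfour_eq_tsum (μ ν : ℕ) (z : ℂ) :
    threeFfour μ ν z = ((μ : ℂ) + ν + 1) * Complex.Gamma (μ + 1) * Complex.Gamma (ν + 1) *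
      ∑' x : ℕ × ℕ, 1 / ((2 * x.1 + μ : ℕ) + (2 * x.2 + ν : ℕ) + 1 : ℂ) *
        ((besselCoeff μ x.1 * z ^ x.1) * (besselCoeff ν x.2 * z ^ x.2)) := by
  have hs : Summable fun x : ℕ × ℕ => 1 / ((2 * x.1 + μ : ℕ) + (2 * x.2 + ν : ℕ) + 1 : ℂ) *
      ((besselCoeff μ x.1 * z ^ x.1) * (besselCoeff ν x.2 * z ^ x.2)) := by
    refine Summable.of_norm_bounded ((summable_norm_besselCoeff_mul_pow μ z).mul_norm
      (summable_norm_besselCoeff_mul_pow ν z)) fun x => ?_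
    rw [norm_mul]
    refine mul_le_of_le_one_left (norm_nonneg _) ?_
    rw [show ((2 * x.1 + μ : ℕ) + (2 * x.2 + ν : ℕ) + 1 : ℂ) =
      ((2 * x.1 + μ + (2 * x.2 + ν) + 1 : ℕ) : ℂ) by push_cast; ring, norm_div, norm_one,
      Complex.norm_natCast, div_le_one (by positivity)]
    exact_mod_cast Nat.le_add_left 1 _
  have h1 := (Finset.HasAntidiagonal.sigmaAntidiagonalEquivProd (A := ℕ)).hasSum_iff.mpr hs.hasSum
  rw [← h1.tsum_eq, h1.summable.tsum_sigma, threeFfour, hgFun_eq_tsum, ← tsum_mul_left]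
  refine tsum_congr fun p => ?_
  rw [hgCoeff_threeFfour, Complex.Gamma_nat_eq_factorial, Complex.Gamma_nat_eq_factorial,
    mul_assoc]
  congr 1
  have hV := congrArg (fun r : ℝ => (r : ℂ)) (sum_antidiagonal_besselCoeff_mul μ ν p)
  push_cast at hV
  rw [← hV, tsum_fintype, Finset.univ_eq_attach, div_mul_eq_mul_div, Finset.sum_mul,
    Finset.sum_div, ← Finset.sum_attach]
  refine Finset.sum_congr rfl fun x _ => ?_
  obtain ⟨⟨m, n⟩, hx⟩ := x
  obtain rfl : m + n = p := by simpa using hx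
  simp only [Function.comp, Finset.HasAntidiagonal.sigmaAntidiagonalEquivProd_apply]
  push_cast
  rw [pow_add]
  ring

/-! ### The limits of the conventional summands -/

/-- On a bounded set, `1 / Γ(w + n)` decays like `2 ^ n / n!`: once `n` exceeds twice the size of
`w` plus one, each step of the functional equation divides by at least `(n + 1) / 2`. -/
theorem exists_norm_inv_Gamma_add_le (c : ℂ) (r : ℝ) :
    ∃ C : ℝ, ∀ (n : ℕ), ∀ w ∈ Metric.closedBall c r,
      ‖(Complex.Gamma (w + n))⁻¹‖ ≤ C * (2 ^ n / n !) := by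
  have hcont : ∀ n : ℕ, Continuous fun w : ℂ => (Complex.Gamma (w + n))⁻¹ := fun n =>
    Complex.differentiable_one_div_Gamma.continuous.comp (by fun_prop)
  have hfin : ∀ N : ℕ, ∃ C : ℝ, ∀ n ≤ N, ∀ w ∈ Metric.closedBall c r,
      ‖(Complex.Gamma (w + n))⁻¹‖ ≤ C * (2 ^ n / n !) := by
    intro N
    induction N with
    | zero =>
      obtain ⟨C, hC⟩ := (isCompact_closedBall c r).exists_bound_of_continuousOn
        (hcont 0).continuousOn
      refine ⟨C, fun n hn w hw => ?_⟩
      obtain rfl : n = 0 := by omega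
      simpa using hC w hw
    | succ N ih =>
      obtain ⟨C, hC⟩ := ih
      obtain ⟨D, hD⟩ := (isCompact_closedBall c r).exists_bound_of_continuousOn
        (hcont (N + 1)).continuousOn
      refine ⟨max C (D / (2 ^ (N + 1) / (N + 1)!)), fun n hn w hw => ?_⟩
      rcases Nat.le_succ_iff.mp hn with h | rfl
      · exact (hC n h w hw).trans
          (mul_le_mul_of_nonneg_right (le_max_left _ _) (by positivity))
      · refine (hD w hw).trans ?_
        rw [← div_le_iff₀ (by positivity)]
        exact le_max_right _ _
  obtain ⟨N, hN⟩ := exists_nat_gt (2 * (‖c‖ + r) + 1)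
  obtain ⟨C, hC⟩ := hfin N
  refine ⟨C, fun n => ?_⟩
  induction n with
  | zero => exact hC 0 (Nat.zero_le _)
  | succ n ih =>
    intro w hw
    rcases lt_or_ge n N with h | h
    · exact hC (n + 1) h w hw
    · have hwn : ‖w‖ ≤ ‖c‖ + r := by
        have h1 := norm_le_norm_add_norm_sub' w c
        have h2 : ‖w - c‖ ≤ r := by simpa [dist_eq_norm] using hw
        linarith
      have hge : ((n : ℝ) + 1) / 2 ≤ ‖w + n‖ := by
        have h1 := norm_sub_norm_le (n : ℂ) (-w)
        rw [Complex.norm_natCast, norm_neg, sub_neg_eq_add, add_comm (n : ℂ)] at h1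
        have h2 : (N : ℝ) ≤ n := by exact_mod_cast h
        linarith
      have hpos : 0 < ‖w + n‖ := lt_of_lt_of_le (by positivity) hge
      rw [show w + ((n + 1 : ℕ) : ℂ) = w + n + 1 by push_cast; ring,
        Complex.Gamma_add_one _ (norm_pos_iff.mp hpos), mul_inv, norm_mul, norm_inv]
      have h3 : ‖w + n‖⁻¹ ≤ 2 / (n + 1) := by
        rw [← inv_div]
        exact inv_anti₀ (by positivity) hge
      calc ‖w + n‖⁻¹ * ‖(Complex.Gamma (w + n))⁻¹‖
          ≤ 2 / (n + 1) * (C * (2 ^ n / n !)) :=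
            mul_le_mul h3 (ih w hw) (norm_nonneg _) (by positivity)
        _ = C * (2 ^ (n + 1) / (n + 1)!) := by
            rw [Nat.factorial_succ]
            push_cast
            field_simp
            ring

/-- The regularized function is continuous in the order, since its coefficients are entire in the
order and the series converges locally uniformly. -/
theorem continuous_regularizedHGFun_order (L : ℕ) (z : ℂ) :
    Continuous fun s : ℂ => Complex.regularizedHGFun (upperParams L) (lowerParams L s) z := by
  have hsum : ∀ s, Complex.regularizedHGFun (upperParams L) (lowerParams L s) z =
      ∑' n, Complex.regularizedHGFunCoeff (upperParams L) (lowerParams L s) n * z ^ n := fun s =>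
    (hasSum_regularizedHGFun (by simp [upperParams, lowerParams]) z).tsum_eq.symm
  simp only [hsum]
  rw [continuous_iff_continuousAt]
  intro s₀
  obtain ⟨C, hC⟩ := exists_norm_inv_Gamma_add_le ((L : ℂ) / 2 - s₀ / 2 + 1) 1
  obtain ⟨D, hD⟩ := exists_norm_inv_Gamma_add_le ((L : ℂ) / 2 + s₀ / 2 + 1) 1
  -- The majorant is itself a regularized hypergeometric series, since `Γ(1 + n) = n!`.
  have hmaj := ((hasSum_regularizedHGFun (a := upperParams L)
    (b := {(L : ℂ) + 3 / 2, 1, 1}) (by simp [upperParams]) (4 * z)).summable.norm.mul_left (C * D))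
  have hcont : ContinuousOn (fun s => ∑' n,
      Complex.regularizedHGFunCoeff (upperParams L) (lowerParams L s) n * z ^ n)
      (Metric.closedBall s₀ 1) := by
    refine continuousOn_tsum (fun n => ?_) hmaj fun n s hs => ?_
    · have h1 : Continuous fun w : ℂ => (Complex.Gamma w)⁻¹ :=
        Complex.differentiable_one_div_Gamma.continuous
      have h2 : Continuous fun s : ℂ => (Complex.Gamma ((L : ℂ) / 2 - s / 2 + 1 + n))⁻¹ :=
        h1.comp (by fun_prop)
      have h3 : Continuous fun s : ℂ => (Complex.Gamma ((L : ℂ) / 2 + s / 2 + 1 + n))⁻¹ :=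
        h1.comp (by fun_prop)
      simp only [regularizedHGFunCoeff_upper_lower, div_eq_mul_inv, mul_inv]
      simp only [div_eq_mul_inv] at h2 h3
      exact Continuous.continuousOn (by fun_prop)
    · have hs' : ‖s - s₀‖ ≤ 1 := by simpa [dist_eq_norm] using hs
      have h1 := hC n ((L : ℂ) / 2 - s / 2 + 1) (by
        rw [Metric.mem_closedBall, dist_eq_norm,
          show (L : ℂ) / 2 - s / 2 + 1 - ((L : ℂ) / 2 - s₀ / 2 + 1) = -((s - s₀) / 2) by ring,
          norm_neg, norm_div]
        norm_num
        linarith)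
      have h2 := hD n ((L : ℂ) / 2 + s / 2 + 1) (by
        rw [Metric.mem_closedBall, dist_eq_norm,
          show (L : ℂ) / 2 + s / 2 + 1 - ((L : ℂ) / 2 + s₀ / 2 + 1) = (s - s₀) / 2 by ring,
          norm_div]
        norm_num
        linarith)
      have e : Complex.regularizedHGFunCoeff (upperParams L) {(L : ℂ) + 3 / 2, 1, 1} n =
          (L + 2 * n)! / (L ! * 4 ^ n) / (n ! * (Complex.Gamma ((L + n : ℕ) + 3 / 2) *
            ((n ! : ℂ) * n !))) := by
        rw [← ascPochhammer_eval_half_mul, ← Complex.Gamma_nat_eq_factorial]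
        simp only [Complex.regularizedHGFunCoeff, upperParams, Multiset.insert_eq_cons,
          Multiset.map_cons, Multiset.map_singleton, Multiset.prod_cons, Multiset.prod_singleton]
        rw [Complex.Gamma_nat_eq_factorial, add_comm (1 : ℂ), Complex.Gamma_nat_eq_factorial]
        push_cast
        congr 4
        ring
      rw [regularizedHGFunCoeff_upper_lower, e]
      have h3 := mul_le_mul h1 h2 (norm_nonneg _) ((norm_nonneg _).trans h1)
      rw [norm_inv, norm_inv] at h3
      simp only [norm_mul, norm_div, norm_pow, Complex.norm_natCast]
      rw [mul_pow]
      have h4 := mul_le_mul_of_nonneg_left h3 (show 0 ≤ ((L + 2 * n)! : ℝ) /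
        (L ! * ‖(4 : ℂ)‖ ^ n) / (n ! * ‖Complex.Gamma ((L + n : ℕ) + 3 / 2)‖) * ‖z‖ ^ n by
          positivity)
      have e4 : ‖(4 : ℂ)‖ = 4 := by norm_num
      have e5 : (4 : ℝ) ^ n = 2 ^ n * 2 ^ n := by rw [← mul_pow]; norm_num
      refine (le_of_eq ?_).trans (h4.trans (le_of_eq ?_))
      · simp only [div_eq_mul_inv, mul_inv]
        ring
      · rw [e4, e5]
        simp only [div_eq_mul_inv, mul_inv]
        ring
  exact hcont.continuousAt (Metric.closedBall_mem_nhds s₀ one_pos)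

/-- Away from the poles of the Gamma functions, the regularized function is the conventional one
divided by the Gamma functions of its lower parameters. -/
theorem hgFun_div_Gamma_eq_regularizedHGFun {L : ℕ} {s : ℂ}
    (h1 : ∀ k : ℕ, (L : ℂ) / 2 - s / 2 + 1 ≠ -k) (h2 : ∀ k : ℕ, (L : ℂ) / 2 + s / 2 + 1 ≠ -k)
    (z : ℂ) :
    hgFun (upperParams L) (lowerParams L s) z / (Complex.Gamma ((L : ℂ) + 3 / 2) *
      (Complex.Gamma ((L : ℂ) / 2 - s / 2 + 1) * Complex.Gamma ((L : ℂ) / 2 + s / 2 + 1))) =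
      Complex.regularizedHGFun (upperParams L) (lowerParams L s) z := by
  have h0 : ∀ k : ℕ, (L : ℂ) + 3 / 2 ≠ -k := by
    intro k h
    have : ((2 * L + 3 + 2 * k : ℕ) : ℂ) = 0 := by
      push_cast
      linear_combination 2 * h
    rw [Nat.cast_eq_zero] at this
    omega
  rw [hgFun_eq_tsum, ← (hasSum_regularizedHGFun (by simp [upperParams, lowerParams]) z).tsum_eq,
    ← tsum_div_const]
  refine tsum_congr fun n => ?_
  simp only [Complex.regularizedHGFunCoeff, hgCoeff, lowerParams, Multiset.insert_eq_cons,
    Multiset.map_cons, Multiset.map_singleton, Multiset.prod_cons, Multiset.prod_singleton]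
  rw [← Complex.Gamma_add_nat_div_Gamma_eq _ h0, ← Complex.Gamma_add_nat_div_Gamma_eq _ h1,
    ← Complex.Gamma_add_nat_div_Gamma_eq _ h2]
  have g0 := Complex.Gamma_ne_zero h0
  have g1 := Complex.Gamma_ne_zero h1
  have g2 := Complex.Gamma_ne_zero h2
  generalize Complex.Gamma ((L : ℂ) + 3 / 2) = A at g0 ⊢
  generalize Complex.Gamma ((L : ℂ) / 2 - s / 2 + 1) = B at g1 ⊢
  generalize Complex.Gamma ((L : ℂ) / 2 + s / 2 + 1) = D at g2 ⊢
  field_simp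

theorem conventionalSummand_eq {L : ℕ} {s t : ℂ}
    (hs : ∀ k : ℕ, (L : ℂ) / 2 - s / 2 + 1 ≠ -k ∧ (L : ℂ) / 2 + s / 2 + 1 ≠ -k)
    (ht : ∀ k : ℕ, (L : ℂ) / 2 - t / 2 + 1 ≠ -k ∧ (L : ℂ) / 2 + t / 2 + 1 ≠ -k)
    (μ ν : ℕ) (z : ℂ) :
    conventionalSummand μ ν L z s t = commonFactor μ ν L * powerFactor μ ν L z *
      Complex.regularizedHGFun (upperParams L) (lowerParams L s) (z / 4) *
      Complex.regularizedHGFun (upperParams L) (lowerParams L t) (z / 4) := by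
  rw [← hgFun_div_Gamma_eq_regularizedHGFun (fun k => (hs k).1) (fun k => (hs k).2),
    ← hgFun_div_Gamma_eq_regularizedHGFun (fun k => (ht k).1) (fun k => (ht k).2),
    conventionalSummand]
  simp only [div_eq_mul_inv, mul_inv]
  ring

theorem not_pole_of_le {L μ : ℕ} (h : μ ≤ L) (k : ℕ) :
    (L : ℂ) / 2 - (μ : ℂ) / 2 + 1 ≠ -k ∧ (L : ℂ) / 2 + (μ : ℂ) / 2 + 1 ≠ -k := by
  obtain ⟨d, rfl⟩ := Nat.exists_eq_add_of_le h
  constructor <;> intro hk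
  · have : ((d + 2 + 2 * k : ℕ) : ℂ) = 0 := by
      push_cast at hk ⊢
      linear_combination 2 * hk
    rw [Nat.cast_eq_zero] at this
    omega
  · have : ((μ + d + μ + 2 + 2 * k : ℕ) : ℂ) = 0 := by
      push_cast at hk ⊢
      linear_combination 2 * hk
    rw [Nat.cast_eq_zero] at this
    omega

/-- The exceptional orders are integers, so a punctured disc of radius one around an integer
contains none of them. -/
theorem eventually_not_pole (L μ : ℕ) :
    ∀ᶠ s in 𝓝[≠] (μ : ℂ),
      ∀ k : ℕ, (L : ℂ) / 2 - s / 2 + 1 ≠ -k ∧ (L : ℂ) / 2 + s / 2 + 1 ≠ -k := by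
  have hball : ∀ᶠ s in 𝓝[≠] (μ : ℂ), s ∈ Metric.ball (μ : ℂ) 1 :=
    nhdsWithin_le_nhds (Metric.ball_mem_nhds _ one_pos)
  filter_upwards [hball, self_mem_nhdsWithin] with s hs hne k
  have hint : ∀ a : ℤ, s ≠ a := by
    rintro a rfl
    rw [Metric.mem_ball, dist_eq_norm, show (a : ℂ) - (μ : ℂ) = ((a - μ : ℤ) : ℂ) by push_cast; rfl,
      Complex.norm_intCast] at hs
    have h0 : a - μ = 0 := Int.abs_lt_one_iff.mp (by exact_mod_cast hs)
    exact hne (by rw [sub_eq_zero.mp h0]; simp)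
  constructor <;> intro hk
  · refine hint (L + 2 + 2 * k) ?_
    push_cast
    linear_combination -2 * hk
  · refine hint (-(L + 2 + 2 * k)) ?_
    push_cast
    linear_combination 2 * hk

theorem tendsto_conventionalSummand (μ ν L : ℕ) (z : ℂ) :
    Tendsto (fun p : ℂ × ℂ => conventionalSummand μ ν L z p.1 p.2)
      (𝓝[≠] (μ : ℂ) ×ˢ 𝓝[≠] (ν : ℂ)) (𝓝 (regularizedSummand μ ν L z)) := by
  have hc := continuous_regularizedHGFun_order L (z / 4)
  have hμ : Tendsto (fun p : ℂ × ℂ => Complex.regularizedHGFun (upperParams L)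
      (lowerParams L p.1) (z / 4)) (𝓝[≠] (μ : ℂ) ×ˢ 𝓝[≠] (ν : ℂ))
      (𝓝 (Complex.regularizedHGFun (upperParams L) (lowerParams L μ) (z / 4))) :=
    ((hc.tendsto _).mono_left nhdsWithin_le_nhds).comp tendsto_fst
  have hν : Tendsto (fun p : ℂ × ℂ => Complex.regularizedHGFun (upperParams L)
      (lowerParams L p.2) (z / 4)) (𝓝[≠] (μ : ℂ) ×ˢ 𝓝[≠] (ν : ℂ))
      (𝓝 (Complex.regularizedHGFun (upperParams L) (lowerParams L ν) (z / 4))) :=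
    ((hc.tendsto _).mono_left nhdsWithin_le_nhds).comp tendsto_snd
  refine (((tendsto_const_nhds.mul hμ).mul hν).congr' ?_)
  filter_upwards [(eventually_not_pole L μ).prod_mk (eventually_not_pole L ν)] with p hp
  exact (conventionalSummand_eq hp.1 hp.2 μ ν z).symm

/-! ### The expansion of the `₃F₄` -/

theorem mainTheorem1 (μ ν : ℕ) (hparity : Even (μ + ν)) (z : ℂ)
    (hz : z ≠ 0 ∨ (μ = ν ∧ μ ≤ 1)) :
    (∃ T : ℕ → ℂ,
      (∀ L : ℕ, Tendsto (fun p : ℂ × ℂ => conventionalSummand μ ν L z p.1 p.2)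
        (𝓝[≠] (μ : ℂ) ×ˢ 𝓝[≠] (ν : ℂ)) (𝓝 (T L))) ∧
      (∀ L : ℕ, (Even (L + μ) → μ ≤ L ∧ ν ≤ L) →
        T L = conventionalSummand μ ν L z (μ : ℂ) (ν : ℂ)) ∧
      Summable T ∧
      threeFfour μ ν z =
        ((μ : ℂ) + (ν : ℂ) + 1) * Complex.Gamma ((μ : ℂ) + 1) * Complex.Gamma ((ν : ℂ) + 1) *
          ∑' L : ℕ, T L) ∧
    Summable (fun L : ℕ => regularizedSummand μ ν L z) ∧
    threeFfour μ ν z =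
      ((μ : ℂ) + (ν : ℂ) + 1) * Complex.Gamma ((μ : ℂ) + 1) * Complex.Gamma ((ν : ℂ) + 1) *
        ∑' L : ℕ, regularizedSummand μ ν L z := by
  have hsum := hasSum_besselMoment_mul hparity z
  simp only [← regularizedSummand_eq hparity hz] at hsum
  have hval : threeFfour μ ν z =
      ((μ : ℂ) + (ν : ℂ) + 1) * Complex.Gamma ((μ : ℂ) + 1) * Complex.Gamma ((ν : ℂ) + 1) *
        ∑' L : ℕ, regularizedSummand μ ν L z := by
    rw [hsum.tsum_eq, threeFfour_eq_tsum]
  refine ⟨⟨fun L => regularizedSummand μ ν L z, fun L => tendsto_conventionalSummand μ ν L z,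
    fun L hL => ?_, hsum.summable, hval⟩, hsum.summable, hval⟩
  by_cases hpar : Even (L + μ)
  · exact (conventionalSummand_eq (not_pole_of_le (hL hpar).1) (not_pole_of_le (hL hpar).2)
      μ ν z).symm
  -- In degrees of the wrong parity both summands vanish with their common factor.
  · simp [regularizedSummand, conventionalSummand, commonFactor_of_odd hpar]
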